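/- \textbf{Definitions.} A $\Delta$-complex $K$ consists of sets $K_n$ ($n\ge 0$) of $n$-cells and faces $d_i\colon K_n\to K_{n-1}$ ($n\ge 1$, $0\le i\le n$) with $d_jd_l=d_{l-1}d_j$ for $j\le l-1$; its boundary maps are $\partial_n x=\sum_{i=0}^n(-1)^id_ix$ on the free abelian groups generated by the $K_n$. The edges of a 2-cell are its faces, the vertices of a 1-cell are its faces, and the vertices of a 2-cell are the faces of its faces. An $\mathcal M$-complex is a connected $\Delta$-complex such that: (0) it has finitely many cells; (1) it has no $m$-cells for $m\ge 3$, every 0-cell is a face of a 1-cell and every 1-cell is a face of a 2-cell; (2) different faces of a 2-cell are different 1-cells, and different faces of a 1-cell are different 0-cells; (3) every 1-cell is an edge of exactly two 2-cells; (4) for every 0-cell $w$, any two 2-cells having $w$ as a vertex are joined by a sequence of 2-cells in which any two consecutive members share an edge having $w$ as a vertex; (5) $\ker\partial_2\cong\mathbf Z$. An $\mathcal M$-complex is an \emph{identity} if it has exactly two 2-cells $u\ne v$ and $d_iu=d_iv$ for $i=0,1,2$; otherwise it is \emph{proper}. For 2-dimensional $\Delta$-complexes $X$, $Y$ with disjoint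 sets of cells, $x\in X_2$ and $y\in Y_2$, the \emph{connected sum} $X\,{}_x\!\circ_y Y$ has $(X_2-\{x\})\cup(Y_2-\{y\})$ as its set of 2-cells; its 1-cells (0-cells) are obtained from $X_1\cup Y_1$ ($X_0\cup Y_0$) by identifying $d_ix$ with $d_iy$ ($d_id_jx$ with $d_id_jy$) for all $i$ (for all $i,j$), and its faces are induced by those of $X$ and $Y$. An $\mathcal M$-complex is \emph{decomposable} if it is isomorphic to a connected sum of two proper $\mathcal M$-complexes. A \emph{cut-triangle} of an $\mathcal M$-complex $K$ is a set $T=\{e_0,e_1,e_2\}\subseteq K_1$ such that $\partial_1(e_0-e_1+e_2)=0$ and the transitive closure of the relation ``$u$ and $v$ share an edge belonging to $K_1-T$'' on $K_2$ is an equivalence relation with exactly two classes. $K$ is \emph{reducible} if it has a cut-triangle. \textbf{Proposition.} An $\mathcal M$-complex is reducible if and only if it is decomposable. -/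

import Mathlib

universe u

/-- An (abstract) `Δ`-complex: sets `K_0, K_1, …` of cells and faces `d_i : K_{n+1} → K_n`,
`0 ≤ i ≤ n + 1`, with `d_i d_{j+1} = d_j d_i` for `i ≤ j`. -/
structure DeltaComplex where
  cell : ℕ → Type u
  face : {n : ℕ} → Fin (n + 2) → cell (n + 1) → cell n
  face_face : ∀ {n : ℕ} (i j : Fin (n + 2)), i ≤ j → ∀ x : cell (n + 2),
    face i (face j.succ x) = face j (face i.castSucc x)

namespace DeltaComplex

/-- A morphism of `Δ`-complexes: functions on cells that commute with the faces. -/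
structure Hom (K L : DeltaComplex.{u}) where
  map : (n : ℕ) → K.cell n → L.cell n
  map_face : ∀ (n : ℕ) (i : Fin (n + 2)) (x : K.cell (n + 1)),
    map n (K.face i x) = L.face i (map (n + 1) x)

/-- `K` and `L` are isomorphic: there is a morphism all of whose components are bijections. -/
def Isomorphic (K L : DeltaComplex.{u}) : Prop :=
  ∃ f : Hom K L, ∀ n, Function.Bijective (f.map n)

section Axioms

variable (K : DeltaComplex.{u})

/-- `e` is an edge of the 2-cell `x`. -/
def IsEdge (e : K.cell 1) (x : K.cell 2) : Prop := ∃ i, K.face i x = e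

/-- `w` is a vertex of the 1-cell `e`. -/
def IsVertexOfEdge (w : K.cell 0) (e : K.cell 1) : Prop := ∃ i, K.face i e = w

/-- `w` is a vertex of the 2-cell `x`: a face of a face of `x`. -/
def IsVertex (w : K.cell 0) (x : K.cell 2) : Prop := ∃ e, K.IsEdge e x ∧ K.IsVertexOfEdge w e

/-- The boundary `∂₁ : C_1 → C_0`, `∂₁ e = d_0 e - d_1 e`, where `C_n` is the free abelian group
on the `n`-cells. -/
noncomputable def boundaryOne : (K.cell 1 →₀ ℤ) →ₗ[ℤ] (K.cell 0 →₀ ℤ) :=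
  Finsupp.linearCombination ℤ fun e : K.cell 1 =>
    Finsupp.single (K.face 0 e) (1 : ℤ) - Finsupp.single (K.face 1 e) 1

/-- The boundary `∂₂ : C_2 → C_1`, `∂₂ x = d_0 x - d_1 x + d_2 x`. -/
noncomputable def boundaryTwo : (K.cell 2 →₀ ℤ) →ₗ[ℤ] (K.cell 1 →₀ ℤ) :=
  Finsupp.linearCombination ℤ fun x : K.cell 2 =>
    Finsupp.single (K.face 0 x) (1 : ℤ) - Finsupp.single (K.face 1 x) 1
      + Finsupp.single (K.face 2 x) 1

/-- Two 0-cells are the pair of vertices of some 1-cell. -/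
def Adjacent (w w' : K.cell 0) : Prop :=
  ∃ e : K.cell 1, (K.face 0 e = w ∧ K.face 1 e = w') ∨ (K.face 0 e = w' ∧ K.face 1 e = w)

/-- Two 2-cells share an edge having `w` as a vertex. -/
def Neighbours (w : K.cell 0) (x x' : K.cell 2) : Prop :=
  ∃ e, K.IsVertexOfEdge w e ∧ K.IsEdge e x ∧ K.IsEdge e x'

/-- `M`-complexes. -/
structure IsMComplex : Prop where
  connected : ∀ w w' : K.cell 0, Relation.ReflTransGen K.Adjacent w w'
  finite : Finite (Σ n, K.cell n)
  /-- Homogeneous of dimension 2. -/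
  empty_of_three_le : ∀ m, 3 ≤ m → IsEmpty (K.cell m)
  exists_edge : ∀ w : K.cell 0, ∃ e, K.IsVertexOfEdge w e
  exists_triangle : ∀ e : K.cell 1, ∃ x, K.IsEdge e x
  /-- Regular: different faces map a cell to different cells. -/
  regular_two : ∀ x : K.cell 2, Function.Injective fun i => K.face i x
  regular_one : ∀ e : K.cell 1, Function.Injective fun i => K.face i e
  /-- Every 1-cell is an edge of exactly two 2-cells. -/
  two_triangles : ∀ e : K.cell 1, {x | K.IsEdge e x}.ncard = 2
  /-- The 2-cells around a 0-cell are linked. -/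
  linked : ∀ (w : K.cell 0) (x x' : K.cell 2), K.IsVertex w x → K.IsVertex w x' →
    Relation.ReflTransGen (K.Neighbours w) x x'
  /-- Orientable: the second homology group is infinite cyclic. As there are no 3-cells, this
  group is the group of 2-cycles. In particular, the complex is not empty. -/
  orientable : Nonempty (LinearMap.ker (K.boundaryTwo) ≃ₗ[ℤ] ℤ)

/-- The identities (units): complexes given by two 2-cells with the same boundaries. -/
def IsIdentity : Prop :=
  ∃ x x' : K.cell 2, x ≠ x' ∧ (∀ z, z = x ∨ z = x') ∧ ∀ i, K.face i x = K.face i x'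

/-- A proper `M`-complex is one that is not an identity. -/
def IsProperMComplex : Prop := K.IsMComplex ∧ ¬ K.IsIdentity

/-- Two 2-cells share an edge that does not belong to `T`. -/
def SharesEdgeOff (T : Set (K.cell 1)) (x x' : K.cell 2) : Prop :=
  ∃ e, e ∉ T ∧ K.IsEdge e x ∧ K.IsEdge e x'

/-- `T = {e₀, e₁, e₂}` is a cut-triangle: `e₀ - e₁ + e₂` is a 1-cycle, and the transitive closure
of the relation of sharing an edge outside `T` is an equivalence relation on the 2-cells with
exactly two classes. -/
def IsCutTriangle (T : Set (K.cell 1)) : Prop :=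
  (∃ e₀ e₁ e₂ : K.cell 1, T = {e₀, e₁, e₂} ∧
    K.boundaryOne (Finsupp.single e₀ 1 - Finsupp.single e₁ 1 + Finsupp.single e₂ 1) = 0) ∧
  ∃ h : Equivalence (Relation.TransGen (K.SharesEdgeOff T)),
    Nat.card (Quotient (Setoid.mk (Relation.TransGen (K.SharesEdgeOff T)) h)) = 2

/-- `K` has a cut-triangle. -/
def IsReducible : Prop := ∃ T, K.IsCutTriangle T

end Axioms

section ConnectedSum

variable (X Y : DeltaComplex.{u}) (x : X.cell 2) (y : Y.cell 2)

/-- The `i`-th edge of `x` is identified with the `i`-th edge of `y`. -/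
inductive EdgeGlue : X.cell 1 ⊕ Y.cell 1 → X.cell 1 ⊕ Y.cell 1 → Prop
  | mk (i : Fin 3) : EdgeGlue (Sum.inl (X.face i x)) (Sum.inr (Y.face i y))

/-- The vertices of `x` are identified with the corresponding vertices of `y`. -/
inductive VertexGlue : X.cell 0 ⊕ Y.cell 0 → X.cell 0 ⊕ Y.cell 0 → Prop
  | mk (i : Fin 2) (j : Fin 3) :
      VertexGlue (Sum.inl (X.face i (X.face j x))) (Sum.inr (Y.face i (Y.face j y)))

/-- The cells of the connected sum: `x` and `y` are deleted, and their boundaries are glued.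
`Quot r` is the quotient by the equivalence relation generated by `r`. -/
def SumCell : ℕ → Type u
  | 0 => Quot (VertexGlue X Y x y)
  | 1 => Quot (EdgeGlue X Y x y)
  | 2 => {z : X.cell 2 // z ≠ x} ⊕ {z : Y.cell 2 // z ≠ y}
  | _ + 3 => PEmpty

/-- The faces of the connected sum, induced by those of `X` and `Y`. -/
def sumFace : {n : ℕ} → Fin (n + 2) → SumCell X Y x y (n + 1) → SumCell X Y x y n
  | 0, i, c => Quot.map (Sum.map (X.face i) (Y.face i))
      (fun _ _ h => by cases h with | mk j => exact VertexGlue.mk i j) c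
  | 1, i, c => Quot.mk _ (Sum.map (fun z => X.face i z.1) (fun z => Y.face i z.1) c)
  | _ + 2, _, c => PEmpty.elim c

/-- The connected sum of 2-dimensional complexes `X` and `Y` with respect to `x` and `y`. -/
def connectedSum : DeltaComplex.{u} where
  cell := SumCell X Y x y
  face := sumFace X Y x y
  face_face := by
    intro n i j hij c
    match n, i, j, hij, c with
    | 0, i, j, hij, Sum.inl z =>
      exact congrArg (fun w => Quot.mk (VertexGlue X Y x y) (Sum.inl w)) (X.face_face i j hij z.1)
    | 0, i, j, hij, Sum.inr z =>
      exact congrArg (fun w => Quot.mk (VertexGlue X Y x y) (Sum.inr w)) (Y.face_face i j hij z.1)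
    | _ + 1, _, _, _, c => exact PEmpty.elim c

end ConnectedSum

/-- `K` is, up to isomorphism (that is, up to the names of the cells), a connected sum of two
proper `M`-complexes. -/
def IsDecomposable (K : DeltaComplex.{u}) : Prop :=
  ∃ (X Y : DeltaComplex.{u}) (x : X.cell 2) (y : Y.cell 2),
    X.IsProperMComplex ∧ Y.IsProperMComplex ∧ K.Isomorphic (connectedSum X Y x y)

end DeltaComplex

/-!
Let `T` be a cut-triangle and `A` one of its two classes of 2-cells. The fundamental cycle of `K`,
restricted to `A`, has a boundary which is a cycle supported on `T`, hence a multiple of the cycle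
of the triangle `T`; the multiple is nonzero, because a cycle that vanishes at one 2-cell vanishes
everywhere. Closing `A` and its complement by one new 2-cell with boundary `T` each therefore yields
two complexes that carry nonzero 2-cycles, that is, orientable ones, and `K` is their connected sum.
They are proper because every 2-cell is related to itself, and so has an edge outside `T`.

Conversely, removing a 2-cell `x` from an `M`-complex leaves a set of 2-cells that is connected off
the edges of `x`: a proper part of it would carry a chain whose boundary is a nonzero multiple of
that of `x`, and subtracting that multiple of `x` would give a nonzero cycle vanishing at some
2-cell. Hence the triangle along which two `M`-complexes are glued has exactly two classes. In
proper summands every remaining 2-cell has an edge that is not an edge of `x`, so that the relation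
is reflexive.
-/

theorem nonempty_linearEquiv_self_of_injective {R M : Type*} [CommRing R] [IsDomain R]
    [IsPrincipalIdealRing R] [AddCommGroup M] [Module R M] [Nontrivial M] (f : M →ₗ[R] R)
    (hf : Function.Injective f) : Nonempty (M ≃ₗ[R] R) := by
  obtain ⟨g, hg⟩ := (IsPrincipalIdealRing.principal (LinearMap.range f)).principal
  have hg₀ : g ≠ 0 := by
    rintro rfl
    obtain ⟨m, hm⟩ := exists_ne (0 : M)
    have hfm : f m ∈ Submodule.span R {0} := hg ▸ LinearMap.mem_range_self f m
    exact hm (hf (by simpa using hfm))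
  exact ⟨(LinearEquiv.ofInjective f hf).trans ((LinearEquiv.ofEq _ _ hg).trans
    (LinearEquiv.toSpanNonzeroSingleton R R g hg₀).symm)⟩

theorem bijective_quotLift_val {α : Type*} {p q : α → Prop} (hpq : ∀ a, p a ∨ q a)
    {r : {a // p a} ⊕ {a // q a} → {a // p a} ⊕ {a // q a} → Prop}
    (hr : ∀ s s', r s s' → Sum.elim Subtype.val Subtype.val s = Sum.elim Subtype.val Subtype.val s')
    (hglue : ∀ a (hp : p a) (hq : q a),
      Quot.mk r (.inl ⟨a, hp⟩) = Quot.mk r (.inr ⟨a, hq⟩)) :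
    Function.Bijective (Quot.lift (Sum.elim Subtype.val Subtype.val) hr) := by
  refine ⟨fun s s' => ?_, fun a => ?_⟩
  · induction s using Quot.inductionOn with | _ s
    induction s' using Quot.inductionOn with | _ s'
    rcases s with ⟨a, ha⟩ | ⟨a, ha⟩ <;> rcases s' with ⟨b, hb⟩ | ⟨b, hb⟩ <;> rintro (rfl : a = b)
    exacts [rfl, hglue a ha hb, (hglue a hb ha).symm, rfl]
  · rcases hpq a with ha | ha
    exacts [⟨Quot.mk _ (.inl ⟨a, ha⟩), rfl⟩, ⟨Quot.mk _ (.inr ⟨a, ha⟩), rfl⟩]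

namespace DeltaComplex

variable {K L : DeltaComplex.{u}}

theorem Isomorphic.symm (h : K.Isomorphic L) : L.Isomorphic K := by
  obtain ⟨f, hf⟩ := h
  let e (n : ℕ) : K.cell n ≃ L.cell n := Equiv.ofBijective (f.map n) (hf n)
  refine ⟨⟨fun n => (e n).symm, fun n i x => ?_⟩, fun n => (e n).symm.bijective⟩
  rw [Equiv.symm_apply_eq]
  change _ = f.map n _
  rw [f.map_face]
  exact congrArg _ ((e (n + 1)).apply_symm_apply x).symm

theorem finite_sigma_of_isEmpty {N : ℕ} (hfinite : ∀ n, Finite (K.cell n))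
    (hempty : ∀ n, N ≤ n → IsEmpty (K.cell n)) : Finite (Σ n, K.cell n) := by
  refine .of_surjective (fun c : Σ n : Fin N, K.cell n => (⟨c.1, c.2⟩ : Σ n, K.cell n)) ?_
  rintro ⟨n, c⟩
  have hn : n < N := not_le.1 fun h => (hempty n h).false c
  exact ⟨⟨⟨n, hn⟩, c⟩, rfl⟩

/-! ### Triangles and their chains -/

/-- `K` has no loops: the two vertices of every 1-cell are different. -/
def Loopless (K : DeltaComplex.{u}) : Prop := ∀ f : K.cell 1, K.face 0 f ≠ K.face 1 f

theorem IsMComplex.loopless (hK : K.IsMComplex) : K.Loopless :=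
  fun f h => absurd (hK.regular_one f h) (by decide)

theorem Loopless.face_injective (hK : K.Loopless) (f : K.cell 1) :
    Function.Injective fun i => K.face i f := by
  intro i j h
  fin_cases i <;> fin_cases j
  exacts [rfl, absurd h (hK f), absurd h.symm (hK f), rfl]

/-- Three 1-cells that fit together like the faces of a 2-cell, whether or not they bound one. -/
@[ext]
structure Triangle (K : DeltaComplex.{u}) where
  edge : Fin 3 → K.cell 1
  face_face : ∀ i j : Fin 2, i ≤ j → K.face i (edge j.succ) = K.face j (edge i.castSucc)

namespace Triangle

/-- The boundary of a 2-cell. -/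
def ofCell (x : K.cell 2) : K.Triangle where
  edge i := K.face i x
  face_face i j hij := K.face_face i j hij x

/-- The set of the edges of a triangle. -/
def edgeSet (t : K.Triangle) : Set (K.cell 1) := Set.range t.edge

/-- The 1-chain `e₀ - e₁ + e₂` of a triangle. -/
noncomputable def chain (t : K.Triangle) : K.cell 1 →₀ ℤ :=
  ∑ i : Fin 3, Finsupp.single (t.edge i) ((-1) ^ (i : ℕ))

variable (t : K.Triangle)

theorem edge_mem_edgeSet (i : Fin 3) : t.edge i ∈ t.edgeSet := Set.mem_range_self i

theorem mem_edgeSet {f : K.cell 1} :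
    f ∈ t.edgeSet ↔ f = t.edge 0 ∨ f = t.edge 1 ∨ f = t.edge 2 := by
  simp only [edgeSet, Set.mem_range, Fin.exists_fin_succ, Fin.exists_fin_zero, eq_comm (a := f)]
  simp

theorem face_zero_one : K.face 0 (t.edge 1) = K.face 0 (t.edge 0) := t.face_face 0 0 le_rfl

theorem face_zero_two : K.face 0 (t.edge 2) = K.face 1 (t.edge 0) := t.face_face 0 1 zero_le_one

theorem face_one_two : K.face 1 (t.edge 2) = K.face 1 (t.edge 1) := t.face_face 1 1 le_rfl

theorem edge_injective (hK : K.Loopless) : Function.Injective t.edge := by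
  intro i j h
  fin_cases i <;> fin_cases j <;>
    grind only [hK (t.edge 0), hK (t.edge 1), hK (t.edge 2),
      t.face_zero_one, t.face_zero_two, t.face_one_two]

/-- The edges 0 and 1 are the only two with the same face `d_0`, and the edges 1 and 2 the only two
with the same face `d_1`; so the set of edges of a triangle determines which one is which. -/
theorem eq_of_edgeSet_subset (hK : K.Loopless) {t t' : K.Triangle} (h : t'.edgeSet ⊆ t.edgeSet) :
    t' = t := by
  have hmem (i) := t.mem_edgeSet.1 (h (t'.edge_mem_edgeSet i))
  have hinj := t'.edge_injective hK
  have hne₀₁ : t'.edge 0 ≠ t'.edge 1 := hinj.ne (by decide)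
  have hne₀₂ : t'.edge 0 ≠ t'.edge 2 := hinj.ne (by decide)
  have hne₁₂ : t'.edge 1 ≠ t'.edge 2 := hinj.ne (by decide)
  have hedge : t'.edge 0 = t.edge 0 ∧ t'.edge 1 = t.edge 1 ∧ t'.edge 2 = t.edge 2 := by
    grind only [hmem 0, hmem 1, hmem 2, hK (t.edge 0), hK (t.edge 1), hK (t.edge 2),
      t.face_zero_one, t.face_zero_two, t.face_one_two,
      t'.face_zero_one, t'.face_zero_two, t'.face_one_two]
  ext i
  fin_cases i
  exacts [hedge.1, hedge.2.1, hedge.2.2]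

theorem chain_eq : t.chain =
    Finsupp.single (t.edge 0) 1 - Finsupp.single (t.edge 1) 1 + Finsupp.single (t.edge 2) 1 := by
  simp [chain, Fin.sum_univ_three, sub_eq_add_neg]

theorem chain_apply_edge (hK : K.Loopless) (i : Fin 3) : t.chain (t.edge i) = (-1) ^ (i : ℕ) := by
  classical
  simp [chain, Finsupp.finsetSum_apply, Finsupp.single_apply, (t.edge_injective hK).eq_iff]

theorem chain_apply_ne_zero (hK : K.Loopless) {f : K.cell 1} (hf : f ∈ t.edgeSet) :
    t.chain f ≠ 0 := by
  obtain ⟨i, rfl⟩ := hf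
  simp [t.chain_apply_edge hK]

theorem chain_apply_of_notMem {f : K.cell 1} (hf : f ∉ t.edgeSet) : t.chain f = 0 := by
  rw [chain, Finsupp.finsetSum_apply]
  exact Finset.sum_eq_zero fun i _ =>
    Finsupp.single_eq_of_ne fun h => hf (h ▸ t.edge_mem_edgeSet i)

theorem mapDomain_chain {φ : L.cell 1 → K.cell 1} {s : L.Triangle} {t : K.Triangle}
    (h : ∀ i, φ (s.edge i) = t.edge i) : Finsupp.mapDomain φ s.chain = t.chain := by
  simp only [chain, Finsupp.mapDomain_finsetSum, Finsupp.mapDomain_single, h]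

end Triangle

theorem boundaryOne_single (f : K.cell 1) (k : ℤ) :
    K.boundaryOne (Finsupp.single f k) =
      Finsupp.single (K.face 0 f) k - Finsupp.single (K.face 1 f) k := by
  simp [boundaryOne, smul_sub]

theorem boundaryTwo_single (x : K.cell 2) (k : ℤ) :
    K.boundaryTwo (Finsupp.single x k) = k • (Triangle.ofCell x).chain := by
  simp [boundaryTwo, Triangle.chain_eq, Triangle.ofCell]

theorem Triangle.boundaryOne_chain (t : K.Triangle) : K.boundaryOne t.chain = 0 := by
  simp only [chain_eq, map_add, map_sub, boundaryOne_single, t.face_zero_one, t.face_zero_two,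
    t.face_one_two]
  abel

theorem boundaryOne_boundaryTwo (c : K.cell 2 →₀ ℤ) : K.boundaryOne (K.boundaryTwo c) = 0 := by
  induction c using Finsupp.induction_linear with
  | zero => simp
  | add c d hc hd => simp [hc, hd]
  | single x k => simp [boundaryTwo_single, Triangle.boundaryOne_chain]

theorem Triangle.exists_eq_smul_chain (hK : K.Loopless) (t : K.Triangle) {z : K.cell 1 →₀ ℤ}
    (hz : ∀ f ∉ t.edgeSet, z f = 0) (hcycle : K.boundaryOne z = 0) : ∃ k : ℤ, z = k • t.chain := by
  classical
  have hsum : z = Finsupp.single (t.edge 0) (z (t.edge 0)) +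
      Finsupp.single (t.edge 1) (z (t.edge 1)) + Finsupp.single (t.edge 2) (z (t.edge 2)) := by
    ext f
    by_cases hf : f ∈ t.edgeSet
    · obtain ⟨i, rfl⟩ := hf
      fin_cases i <;> simp [(t.edge_injective hK).eq_iff]
    · have hne (i) : t.edge i ≠ f := fun h => hf ⟨i, h⟩
      simp [hz f hf, hne]
  have h₀ := hK (t.edge 0)
  have h₁ := t.face_zero_one ▸ hK (t.edge 1)
  have h₂ := t.face_one_two ▸ t.face_zero_two ▸ hK (t.edge 2)
  rw [hsum] at hcycle
  simp only [map_add, boundaryOne_single, t.face_zero_one, t.face_zero_two,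
    t.face_one_two] at hcycle
  have hv₀ := DFunLike.congr_fun hcycle (K.face 0 (t.edge 0))
  have hv₁ := DFunLike.congr_fun hcycle (K.face 1 (t.edge 1))
  have hsum₀₁ : z (t.edge 0) + z (t.edge 1) = 0 := by simpa [h₀.symm, h₁.symm] using hv₀
  have hsum₁₂ : -z (t.edge 1) + -z (t.edge 2) = 0 := by simpa [h₁, h₂] using hv₁
  have hz₁ : z (t.edge 1) = -z (t.edge 0) := by linarith
  have hz₂ : z (t.edge 2) = z (t.edge 0) := by linarith
  refine ⟨z (t.edge 0), hsum.trans ?_⟩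
  simp [Triangle.chain_eq, hz₁, hz₂, smul_add, smul_sub, ← sub_eq_add_neg]

/-- The triangle with the given edges. -/
def Triangle.ofEdges (e₀ e₁ e₂ : K.cell 1) (h₀₁ : K.face 0 e₁ = K.face 0 e₀)
    (h₀₂ : K.face 0 e₂ = K.face 1 e₀) (h₁₂ : K.face 1 e₂ = K.face 1 e₁) : K.Triangle where
  edge := ![e₀, e₁, e₂]
  face_face i j hij := by
    fin_cases i <;> fin_cases j
    exacts [h₀₁, h₀₂, absurd hij (by decide), h₁₂]

theorem exists_triangle_edgeSet_eq (hK : K.Loopless) {e₀ e₁ e₂ : K.cell 1}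
    (h : K.boundaryOne (Finsupp.single e₀ 1 - Finsupp.single e₁ 1 + Finsupp.single e₂ 1) = 0) :
    ∃ t : K.Triangle, t.edgeSet = {e₀, e₁, e₂} := by
  classical
  have hcoeff (w) := DFunLike.congr_fun h w
  simp only [map_add, map_sub, boundaryOne_single, Finsupp.add_apply, Finsupp.sub_apply,
    Finsupp.single_apply, Finsupp.zero_apply] at hcoeff
  have hfaces : (K.face 0 e₁ = K.face 0 e₀ ∧ K.face 0 e₂ = K.face 1 e₀ ∧
        K.face 1 e₂ = K.face 1 e₁) ∨
      (K.face 0 e₁ = K.face 0 e₂ ∧ K.face 0 e₀ = K.face 1 e₂ ∧ K.face 1 e₀ = K.face 1 e₁) := by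
    grind only [hK e₀, hK e₁, hK e₂, hcoeff (K.face 0 e₀), hcoeff (K.face 1 e₀),
      hcoeff (K.face 0 e₁), hcoeff (K.face 1 e₁), hcoeff (K.face 0 e₂), hcoeff (K.face 1 e₂)]
  rcases hfaces with ⟨h₀₁, h₀₂, h₁₂⟩ | ⟨h₀₁, h₀₂, h₁₂⟩
  · exact ⟨.ofEdges e₀ e₁ e₂ h₀₁ h₀₂ h₁₂, by ext; simp [Triangle.mem_edgeSet, Triangle.ofEdges]⟩
  · refine ⟨.ofEdges e₂ e₁ e₀ h₀₁ h₀₂ h₁₂, ?_⟩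
    ext
    simp only [Triangle.mem_edgeSet, Triangle.ofEdges, Matrix.cons_val, Set.mem_insert_iff,
      Set.mem_singleton_iff]
    tauto

theorem boundaryTwo_apply_eq_zero {c : K.cell 2 →₀ ℤ} {f : K.cell 1}
    (h : ∀ x, K.IsEdge f x → c x = 0) : K.boundaryTwo c f = 0 := by
  rw [← c.sum_single, map_finsuppSum, Finsupp.sum, Finsupp.finsetSum_apply]
  refine Finset.sum_eq_zero fun x _ => ?_
  rw [boundaryTwo_single, Finsupp.smul_apply]
  by_cases hx : K.IsEdge f x
  · rw [h x hx, zero_smul]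
  · rw [(Triangle.ofCell x).chain_apply_of_notMem hx, smul_zero]

theorem boundaryTwo_apply_congr {c d : K.cell 2 →₀ ℤ} {f : K.cell 1}
    (h : ∀ x, K.IsEdge f x → c x = d x) : K.boundaryTwo c f = K.boundaryTwo d f := by
  rw [← sub_eq_zero, ← Finsupp.sub_apply, ← map_sub]
  exact boundaryTwo_apply_eq_zero fun x hx => by simp [h x hx]

/-! ### Sets of 2-cells and their frontiers -/

/-- Two 2-cells share an edge that belongs to `S`. With `S = Tᶜ` this is `SharesEdgeOff T`, and with
`S` the set of 1-cells at a vertex `w` it is `Neighbours w`. -/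
def SharesEdgeIn (K : DeltaComplex.{u}) (S : Set (K.cell 1)) (x x' : K.cell 2) : Prop :=
  ∃ f ∈ S, K.IsEdge f x ∧ K.IsEdge f x'

/-- The frontier of a set `A` of 2-cells: the 1-cells along which `A` meets its complement. -/
def frontier (K : DeltaComplex.{u}) (A : Set (K.cell 2)) : Set (K.cell 1) :=
  {f | ∃ a ∈ A, ∃ b ∉ A, K.IsEdge f a ∧ K.IsEdge f b}

theorem frontier_compl (A : Set (K.cell 2)) : K.frontier Aᶜ = K.frontier A := by
  ext f
  constructor
  · rintro ⟨b, hb, a, ha, hfb, hfa⟩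
    exact ⟨a, not_not.1 ha, b, hb, hfa, hfb⟩
  · rintro ⟨a, ha, b, hb, hfa, hfb⟩
    exact ⟨b, hb, a, not_not.2 ha, hfb, hfa⟩

theorem exists_mem_frontier_of_reflTransGen {S : Set (K.cell 1)} {A : Set (K.cell 2)}
    {a b : K.cell 2} (h : Relation.ReflTransGen (K.SharesEdgeIn S) a b) (ha : a ∈ A) (hb : b ∉ A) :
    ∃ f ∈ S, f ∈ K.frontier A := by
  induction h with
  | refl => exact absurd ha hb
  | @tail c d _ hcd ih =>
    by_cases hc : c ∈ A
    · obtain ⟨f, hf, hfc, hfd⟩ := hcd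
      exact ⟨f, hf, c, hc, d, hb, hfc, hfd⟩
    · exact ih hc

theorem frontier_setOf_reflTransGen_subset (S : Set (K.cell 1)) (a : K.cell 2) :
    K.frontier {b | Relation.ReflTransGen (K.SharesEdgeIn S) a b} ⊆ Sᶜ := by
  rintro f ⟨b, hb, b', hb', hfb, hfb'⟩ hf
  exact hb' (hb.tail ⟨f, hf, hfb, hfb'⟩)

theorem setOf_isEdge_eq_pair {f : K.cell 1} (hf : {x | K.IsEdge f x}.ncard = 2)
    {a a' : K.cell 2} (ha : K.IsEdge f a) (ha' : K.IsEdge f a') (hne : a ≠ a') :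
    {x | K.IsEdge f x} = {a, a'} := by
  have hsubset : {a, a'} ⊆ {x | K.IsEdge f x} := Set.pair_subset ha ha'
  exact (Set.eq_of_subset_of_ncard_le hsubset (by rw [hf, Set.ncard_pair hne])
    (Set.finite_of_ncard_pos (by lia))).symm

/-! ### Pseudosurfaces -/

/-- A closed surface with isolated singularities: what remains of the axioms of an `M`-complex when
the links of the vertices may be disconnected and orientability is dropped. -/
structure IsPseudosurface (K : DeltaComplex.{u}) : Prop where
  loopless : K.Loopless
  two_triangles : ∀ f : K.cell 1, {x | K.IsEdge f x}.ncard = 2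
  stronglyConnected : ∀ x x', Relation.ReflTransGen (K.SharesEdgeIn Set.univ) x x'

theorem isVertex_face_face (i : Fin 2) (j : Fin 3) (x : K.cell 2) :
    K.IsVertex (K.face i (K.face j x)) x :=
  ⟨_, ⟨j, rfl⟩, i, rfl⟩

theorem IsMComplex.isPseudosurface (hK : K.IsMComplex) : K.IsPseudosurface where
  loopless := hK.loopless
  two_triangles := hK.two_triangles
  stronglyConnected x x' := by
    have around {w y y'} (hy : K.IsVertex w y) (hy' : K.IsVertex w y') :
        Relation.ReflTransGen (K.SharesEdgeIn Set.univ) y y' :=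
      Relation.ReflTransGen.mono (fun _ _ ⟨f, _, h⟩ => ⟨f, trivial, h⟩) _ _
        (hK.linked w y y' hy hy')
    suffices ∀ w, Relation.ReflTransGen K.Adjacent (K.face 0 (K.face 0 x)) w →
        ∀ y, K.IsVertex w y → Relation.ReflTransGen (K.SharesEdgeIn Set.univ) x y from
      this _ (hK.connected _ _) x' (isVertex_face_face 0 0 x')
    intro w hw
    induction hw with
    | refl => exact fun y hy => around (isVertex_face_face 0 0 x) hy
    | tail _ hadj ih =>
      intro y hy
      obtain ⟨f, hf⟩ := hadj
      obtain ⟨z, hz⟩ := hK.exists_triangle f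
      rcases hf with ⟨rfl, rfl⟩ | ⟨rfl, rfl⟩
      · exact (ih z ⟨f, hz, 0, rfl⟩).trans (around ⟨f, hz, 1, rfl⟩ hy)
      · exact (ih z ⟨f, hz, 1, rfl⟩).trans (around ⟨f, hz, 0, rfl⟩ hy)

theorem reflTransGen_adjacent_of_isVertexOfEdge {w w' : K.cell 0} {f : K.cell 1}
    (hw : K.IsVertexOfEdge w f) (hw' : K.IsVertexOfEdge w' f) :
    Relation.ReflTransGen K.Adjacent w w' := by
  obtain ⟨i, rfl⟩ := hw
  obtain ⟨j, rfl⟩ := hw'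
  fin_cases i <;> fin_cases j
  exacts [.refl, .single ⟨f, .inl ⟨rfl, rfl⟩⟩, .single ⟨f, .inr ⟨rfl, rfl⟩⟩, .refl]

theorem IsVertex.exists_isVertexOfEdge_face_zero_face_zero {w : K.cell 0} {x : K.cell 2}
    (hw : K.IsVertex w x) :
    ∃ f, K.IsVertexOfEdge w f ∧ K.IsVertexOfEdge (K.face 0 (K.face 0 x)) f := by
  obtain ⟨_, ⟨j, rfl⟩, i, rfl⟩ := hw
  let t := Triangle.ofCell x
  fin_cases j
  · exact ⟨K.face 0 x, ⟨i, rfl⟩, 0, rfl⟩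
  · exact ⟨K.face 1 x, ⟨i, rfl⟩, 0, t.face_zero_one⟩
  · fin_cases i
    · exact ⟨K.face 0 x, ⟨1, t.face_zero_two.symm⟩, 0, rfl⟩
    · exact ⟨K.face 1 x, ⟨1, t.face_one_two.symm⟩, 0, t.face_zero_one⟩

theorem reflTransGen_adjacent_of_isVertex {w w' : K.cell 0} {x : K.cell 2} (hw : K.IsVertex w x)
    (hw' : K.IsVertex w' x) : Relation.ReflTransGen K.Adjacent w w' := by
  obtain ⟨f, hwf, hf⟩ := hw.exists_isVertexOfEdge_face_zero_face_zero
  obtain ⟨f', hwf', hf'⟩ := hw'.exists_isVertexOfEdge_face_zero_face_zero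
  exact (reflTransGen_adjacent_of_isVertexOfEdge hwf hf).trans
    (reflTransGen_adjacent_of_isVertexOfEdge hf' hwf')

theorem boundaryTwo_apply_of_isEdge {f : K.cell 1} (hf : {x | K.IsEdge f x}.ncard = 2)
    {a a' : K.cell 2} (ha : K.IsEdge f a) (ha' : K.IsEdge f a') (hne : a ≠ a')
    (c : K.cell 2 →₀ ℤ) :
    K.boundaryTwo c f =
      c a * (Triangle.ofCell a).chain f + c a' * (Triangle.ofCell a').chain f := by
  classical
  rw [boundaryTwo_apply_congr (d := Finsupp.single a (c a) + Finsupp.single a' (c a'))]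
  · simp [boundaryTwo_single]
  · intro x hx
    have hmem : x ∈ ({a, a'} : Set _) := setOf_isEdge_eq_pair hf ha ha' hne ▸ hx
    rcases hmem with rfl | rfl <;> simp [hne, hne.symm]

namespace IsPseudosurface

theorem connected (hK : K.IsPseudosurface) (hvertex : ∀ w, ∃ x, K.IsVertex w x)
    (w w' : K.cell 0) : Relation.ReflTransGen K.Adjacent w w' := by
  obtain ⟨x, hwx⟩ := hvertex w
  obtain ⟨x', hwx'⟩ := hvertex w'
  induction hK.stronglyConnected x x' generalizing w' with
  | refl => exact reflTransGen_adjacent_of_isVertex hwx hwx'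
  | tail _ hyz ih =>
    obtain ⟨f, -, hfy, hfz⟩ := hyz
    exact (ih _ ⟨f, hfy, 0, rfl⟩).trans (reflTransGen_adjacent_of_isVertex ⟨f, hfz, 0, rfl⟩ hwx')

theorem eq_zero_of_boundaryTwo_eq_zero (hK : K.IsPseudosurface) {c : K.cell 2 →₀ ℤ}
    (hc : K.boundaryTwo c = 0) {x : K.cell 2} (hx : c x = 0) : c = 0 := by
  ext x'
  induction hK.stronglyConnected x x' with
  | refl => exact hx
  | @tail y z _ hyz ih =>
    obtain ⟨f, -, hfy, hfz⟩ := hyz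
    rcases eq_or_ne y z with rfl | hne
    · exact ih
    have hf := DFunLike.congr_fun hc f
    rw [boundaryTwo_apply_of_isEdge (hK.two_triangles f) hfy hfz hne, ih, Finsupp.zero_apply,
      zero_mul, zero_add, Finsupp.zero_apply] at hf
    exact (mul_eq_zero.1 hf).resolve_right
      ((Triangle.ofCell z).chain_apply_ne_zero hK.loopless hfz)

theorem nonempty_ker_boundaryTwo_equiv (hK : K.IsPseudosurface)
    [Nontrivial (LinearMap.ker K.boundaryTwo)] :
    Nonempty (LinearMap.ker K.boundaryTwo ≃ₗ[ℤ] ℤ) := by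
  obtain ⟨c, hc⟩ := exists_ne (0 : LinearMap.ker K.boundaryTwo)
  obtain ⟨x, -⟩ := Finsupp.ne_iff.1 (Subtype.coe_ne_coe.2 hc)
  refine nonempty_linearEquiv_self_of_injective
    ((Finsupp.lapply x).comp (LinearMap.ker K.boundaryTwo).subtype)
    ((injective_iff_map_eq_zero _).2 fun d hd => ?_)
  exact Subtype.ext (hK.eq_zero_of_boundaryTwo_eq_zero d.2 hd)

end IsPseudosurface

theorem IsMComplex.nontrivial_ker_boundaryTwo (hK : K.IsMComplex) :
    Nontrivial (LinearMap.ker K.boundaryTwo) :=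
  hK.orientable.some.toEquiv.nontrivial

/-! ### Separating triangles -/

/-- The triangle `t` separates `A` from its complement. Unlike for a cut-triangle, the two parts
need not be connected, and there may be 2-cells all of whose edges are edges of `t`. -/
structure Triangle.Separates (t : K.Triangle) (A : Set (K.cell 2)) : Prop where
  nonempty : A.Nonempty
  nonempty_compl : Aᶜ.Nonempty
  frontier_subset : K.frontier A ⊆ t.edgeSet

namespace Triangle.Separates

variable {t : K.Triangle} {A : Set (K.cell 2)}

theorem compl (h : t.Separates A) : t.Separates Aᶜ where
  nonempty := h.nonempty_compl
  nonempty_compl := by rw [compl_compl]; exact h.nonempty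
  frontier_subset := by rw [frontier_compl]; exact h.frontier_subset

theorem boundaryTwo_filter_apply (h : t.Separates A) [DecidablePred (· ∈ A)]
    {c : K.cell 2 →₀ ℤ} (hc : K.boundaryTwo c = 0) {f : K.cell 1} (hf : f ∉ t.edgeSet) :
    K.boundaryTwo (c.filter (· ∈ A)) f = 0 := by
  by_cases hfA : ∃ a ∈ A, K.IsEdge f a
  · obtain ⟨a, ha, hfa⟩ := hfA
    rw [boundaryTwo_apply_congr (d := c), hc, Finsupp.zero_apply]
    intro b hb
    refine Finsupp.filter_apply_pos _ _ (by_contra fun hbA => hf ?_)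
    exact h.frontier_subset ⟨a, ha, b, hbA, hfa, hb⟩
  · push Not at hfA
    exact boundaryTwo_apply_eq_zero fun x hx =>
      Finsupp.filter_apply_neg _ _ fun hxA => hfA x hxA hx

theorem exists_boundaryTwo_eq_smul_chain (h : t.Separates A) (hK : K.IsPseudosurface)
    [Nontrivial (LinearMap.ker K.boundaryTwo)] :
    ∃ d : K.cell 2 →₀ ℤ, (d.support : Set (K.cell 2)) = A ∧
      ∃ k : ℤ, k ≠ 0 ∧ K.boundaryTwo d = k • t.chain := by
  classical
  obtain ⟨⟨c, hc⟩, hc₀⟩ := exists_ne (0 : LinearMap.ker K.boundaryTwo)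
  have hc_apply (x) : c x ≠ 0 := fun hx =>
    hc₀ (Subtype.ext (hK.eq_zero_of_boundaryTwo_eq_zero hc hx))
  obtain ⟨k, hk⟩ := t.exists_eq_smul_chain hK.loopless
    (fun f hf => h.boundaryTwo_filter_apply hc hf) (boundaryOne_boundaryTwo _)
  refine ⟨c.filter (· ∈ A), by ext x; simp [hc_apply], k, ?_, hk⟩
  rintro rfl
  obtain ⟨a, ha⟩ := h.nonempty
  obtain ⟨b, hb⟩ := h.nonempty_compl
  rw [zero_smul] at hk
  have hzero := hK.eq_zero_of_boundaryTwo_eq_zero hk (Finsupp.filter_apply_neg _ c hb)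
  exact hc_apply a ((Finsupp.filter_apply_pos _ c ha).symm.trans (DFunLike.congr_fun hzero a))

theorem exists_mem_isEdge (h : t.Separates A) (hK : K.IsPseudosurface)
    [Nontrivial (LinearMap.ker K.boundaryTwo)] {f : K.cell 1} (hf : f ∈ t.edgeSet) :
    ∃ a ∈ A, K.IsEdge f a := by
  obtain ⟨d, rfl, k, hk, hd⟩ := h.exists_boundaryTwo_eq_smul_chain hK
  by_contra! hfd
  have hzero : K.boundaryTwo d f = 0 := boundaryTwo_apply_eq_zero fun x hx =>
    Finsupp.notMem_support_iff.1 fun hxd => hfd x hxd hx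
  rw [hd, Finsupp.smul_apply, smul_eq_mul] at hzero
  exact mul_ne_zero hk (t.chain_apply_ne_zero hK.loopless hf) hzero

theorem frontier_eq (h : t.Separates A) (hK : K.IsPseudosurface)
    [Nontrivial (LinearMap.ker K.boundaryTwo)] : K.frontier A = t.edgeSet := by
  refine h.frontier_subset.antisymm fun f hf => ?_
  obtain ⟨a, ha, hfa⟩ := h.exists_mem_isEdge hK hf
  obtain ⟨b, hb, hfb⟩ := h.compl.exists_mem_isEdge hK hf
  exact ⟨a, ha, b, hb, hfa, hfb⟩

/-- Otherwise subtracting a multiple of `x` from a chain with support `A` would give a nonzero cycle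
that vanishes at some 2-cell. -/
theorem eq_compl_singleton {x : K.cell 2} (h : (Triangle.ofCell x).Separates A)
    (hK : K.IsPseudosurface) [Nontrivial (LinearMap.ker K.boundaryTwo)] (hx : x ∉ A) :
    A = {x}ᶜ := by
  obtain ⟨d, rfl, k, hk, hd⟩ := h.exists_boundaryTwo_eq_smul_chain hK
  have hcycle : K.boundaryTwo (d - Finsupp.single x k) = 0 := by
    rw [map_sub, hd, boundaryTwo_single, sub_self]
  have hdx : d x = 0 := Finsupp.notMem_support_iff.1 hx
  refine Set.Subset.antisymm (fun y hy => ?_) fun y hyx => ?_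
  · rintro rfl
    exact hx hy
  · by_contra hy
    have hdy : (d - Finsupp.single x k) y = 0 := by
      rw [Finsupp.sub_apply, Finsupp.notMem_support_iff.1 hy,
        Finsupp.single_eq_of_ne hyx, sub_zero]
    have hzero := DFunLike.congr_fun (hK.eq_zero_of_boundaryTwo_eq_zero hcycle hdy) x
    rw [Finsupp.sub_apply, hdx, Finsupp.single_eq_same, zero_sub] at hzero
    exact hk (neg_eq_zero.1 hzero)

end Triangle.Separates

/-! ### A criterion for reducibility -/

namespace Triangle.Separates

variable {t : K.Triangle} {A : Set (K.cell 2)}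

theorem mem_of_reflTransGen (h : t.Separates A) {a b : K.cell 2}
    (hab : Relation.ReflTransGen (K.SharesEdgeOff t.edgeSet) a b) (ha : a ∈ A) : b ∈ A := by
  by_contra hb
  obtain ⟨f, hft, hf⟩ := exists_mem_frontier_of_reflTransGen (S := t.edgeSetᶜ) hab ha hb
  exact hft (h.frontier_subset hf)

theorem isReducible (h : t.Separates A) (hrefl : ∀ a, K.SharesEdgeOff t.edgeSet a a)
    (hconn : ∀ a ∈ A, ∀ b ∈ A, Relation.ReflTransGen (K.SharesEdgeOff t.edgeSet) a b)
    (hconn' : ∀ a ∈ Aᶜ, ∀ b ∈ Aᶜ, Relation.ReflTransGen (K.SharesEdgeOff t.edgeSet) a b) :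
    K.IsReducible := by
  have hrel : Relation.TransGen (K.SharesEdgeOff t.edgeSet) = fun a b => (a ∈ A ↔ b ∈ A) := by
    funext a b
    refine propext ⟨fun hab => ⟨h.mem_of_reflTransGen hab.to_reflTransGen, not_imp_not.1 ?_⟩,
      fun hab => .head' (hrefl a) ?_⟩
    · exact h.compl.mem_of_reflTransGen hab.to_reflTransGen
    · by_cases ha : a ∈ A
      · exact hconn a ha b (hab.1 ha)
      · exact hconn' a ha b fun hb => ha (hab.2 hb)
  refine ⟨t.edgeSet, ⟨t.edge 0, t.edge 1, t.edge 2, ?_, ?_⟩, ?_⟩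
  · ext f
    exact t.mem_edgeSet
  · rw [← t.chain_eq, t.boundaryOne_chain]
  · rw [hrel]
    obtain ⟨a, ha⟩ := h.nonempty
    obtain ⟨b, hb⟩ := h.nonempty_compl
    refine ⟨⟨fun _ => Iff.rfl, Iff.symm, Iff.trans⟩, Nat.card_eq_two_iff.2
      ⟨Quotient.mk _ a, Quotient.mk _ b, fun hab => hb ((Quotient.exact hab).1 ha),
        Set.eq_univ_of_forall fun q => ?_⟩⟩
    induction q using Quotient.inductionOn with | _ c
    by_cases hc : c ∈ A
    · exact .inl (Quotient.sound (iff_of_true hc ha))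
    · exact .inr (Quotient.sound (iff_of_false hc hb))

end Triangle.Separates

theorem IsReducible.exists_separates (h : K.IsReducible) (hK : K.Loopless) :
    ∃ (t : K.Triangle) (A : Set (K.cell 2)), t.Separates A ∧
      ∀ a, K.SharesEdgeOff t.edgeSet a a := by
  obtain ⟨T, ⟨e₀, e₁, e₂, hT, hcycle⟩, hequiv, hcard⟩ := h
  obtain ⟨t, ht⟩ := exists_triangle_edgeSet_eq hK hcycle
  obtain rfl : t.edgeSet = T := ht.trans hT.symm
  obtain ⟨q, q', hqq', -⟩ := Nat.card_eq_two_iff.1 hcard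
  induction q using Quotient.inductionOn with | _ a
  induction q' using Quotient.inductionOn with | _ b
  refine ⟨t, {c | Relation.ReflTransGen (K.SharesEdgeOff t.edgeSet) a c},
    ⟨⟨a, .refl⟩, ⟨b, fun hab => hqq' ?_⟩, fun f hf => not_not.1 ?_⟩, fun c => ?_⟩
  · rcases Relation.reflTransGen_iff_eq_or_transGen.1 hab with rfl | hab
    exacts [rfl, Quotient.sound hab]
  · exact frontier_setOf_reflTransGen_subset t.edgeSetᶜ a hf
  · obtain ⟨_, ⟨f, hf, hfc, -⟩, -⟩ := Relation.TransGen.head'_iff.1 (hequiv.refl c)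
    exact ⟨f, hf, hfc, hfc⟩

/-! ### Removing a 2-cell -/

section Puncture

variable {X Y : DeltaComplex.{u}} {x : X.cell 2} {y : Y.cell 2}

theorem IsPseudosurface.exists_ne (hX : X.IsPseudosurface) (x : X.cell 2) : ∃ a, a ≠ x := by
  obtain ⟨a, -, ha⟩ := Set.exists_ne_of_one_lt_ncard
    (by rw [hX.two_triangles (X.face 0 x)]; exact one_lt_two) x
  exact ⟨a, ha⟩

theorem IsPseudosurface.reflTransGen_sharesEdgeOff (hX : X.IsPseudosurface)
    [Nontrivial (LinearMap.ker X.boundaryTwo)] {a b : X.cell 2} (ha : a ≠ x) (hb : b ≠ x) :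
    Relation.ReflTransGen (X.SharesEdgeOff (Triangle.ofCell x).edgeSet) a b := by
  let A : Set (X.cell 2) :=
    {b | Relation.ReflTransGen (X.SharesEdgeOff (Triangle.ofCell x).edgeSet) a b}
  have hxA : x ∉ A := by
    intro hax
    rcases Relation.ReflTransGen.cases_tail hax with rfl | ⟨_, _, f, hf, _, hfx⟩
    exacts [ha rfl, hf hfx]
  have hsep : (Triangle.ofCell x).Separates A :=
    ⟨⟨a, .refl⟩, ⟨x, hxA⟩, fun f hf =>
      not_not.1 (frontier_setOf_reflTransGen_subset (Triangle.ofCell x).edgeSetᶜ a hf)⟩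
  have hA := hsep.eq_compl_singleton hX hxA
  exact hA.ge hb

/-- Two 2-cells with the same boundary exhaust the two 2-cells at each of their edges, so that no
other 2-cell can be reached from them. -/
theorem IsPseudosurface.isIdentity_of_ofCell_eq (hX : X.IsPseudosurface) {a x : X.cell 2}
    (hax : a ≠ x) (h : Triangle.ofCell a = Triangle.ofCell x) : X.IsIdentity := by
  have hface (i) : X.face i x = X.face i a := congrFun (congrArg Triangle.edge h.symm) i
  refine ⟨x, a, hax.symm, fun z => ?_, hface⟩
  induction hX.stronglyConnected x z with
  | refl => exact .inl rfl
  | @tail y z _ hyz ih =>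
    obtain ⟨f, -, hfy, hfz⟩ := hyz
    obtain ⟨i, rfl⟩ : X.IsEdge f x := by
      rcases ih with rfl | rfl
      exacts [hfy, hfy.imp fun i hi => (hface i).trans hi]
    exact (setOf_isEdge_eq_pair (hX.two_triangles _) ⟨i, rfl⟩ ⟨i, (hface i).symm⟩ hax.symm).le hfz

theorem IsProperMComplex.exists_isEdge_notMem (hX : X.IsProperMComplex) {a x : X.cell 2}
    (hax : a ≠ x) : ∃ f, X.IsEdge f a ∧ f ∉ (Triangle.ofCell x).edgeSet := by
  by_contra! h
  exact hX.2 (hX.1.isPseudosurface.isIdentity_of_ofCell_eq hax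
    (Triangle.eq_of_edgeSet_subset hX.1.loopless h))

/-- A map from the complex `X` without its 2-cell `x` to `K`, injective on 1-cells. The 0-cells are
left out, as only the incidence of 1-cells and 2-cells matters here. -/
structure PuncturedEmbedding (X : DeltaComplex.{u}) (x : X.cell 2) (K : DeltaComplex.{u}) where
  edge : X.cell 1 → K.cell 1
  triangle : {z : X.cell 2 // z ≠ x} → K.cell 2
  edge_injective : Function.Injective edge
  face_triangle : ∀ i z, K.face i (triangle z) = edge (X.face i z.1)

namespace PuncturedEmbedding

/-- The composition of an embedding with a morphism that is injective on 1-cells. -/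
def comp (ι : PuncturedEmbedding X x K) (φ : Hom K L) (hφ : Function.Injective (φ.map 1)) :
    PuncturedEmbedding X x L where
  edge := φ.map 1 ∘ ι.edge
  triangle := φ.map 2 ∘ ι.triangle
  edge_injective := hφ.comp ι.edge_injective
  face_triangle i z := (φ.map_face 1 i _).symm.trans (congrArg _ (ι.face_triangle i z))

variable (ι : PuncturedEmbedding X x K)

theorem isEdge_triangle_iff {f : K.cell 1} {z : {z : X.cell 2 // z ≠ x}} :
    K.IsEdge f (ι.triangle z) ↔ ∃ g, X.IsEdge g z.1 ∧ ι.edge g = f := by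
  simp only [IsEdge, ι.face_triangle, exists_exists_eq_and]

theorem sharesEdgeOff_triangle {S : Set (X.cell 1)} {a b : {z : X.cell 2 // z ≠ x}}
    (h : X.SharesEdgeOff S a.1 b.1) :
    K.SharesEdgeOff (ι.edge '' S) (ι.triangle a) (ι.triangle b) := by
  obtain ⟨f, hf, hfa, hfb⟩ := h
  exact ⟨ι.edge f, ι.edge_injective.mem_set_image.not.2 hf, ι.isEdge_triangle_iff.2 ⟨f, hfa, rfl⟩,
    ι.isEdge_triangle_iff.2 ⟨f, hfb, rfl⟩⟩

theorem reflTransGen_sharesEdgeOff (hX : X.IsPseudosurface)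
    [Nontrivial (LinearMap.ker X.boundaryTwo)] (a b : {z : X.cell 2 // z ≠ x}) :
    Relation.ReflTransGen (K.SharesEdgeOff (ι.edge '' (Triangle.ofCell x).edgeSet))
      (ι.triangle a) (ι.triangle b) := by
  obtain ⟨b, hb⟩ := b
  induction hX.reflTransGen_sharesEdgeOff a.2 hb with
  | refl => exact .refl
  | @tail c d _ hcd ih =>
    have hc : c ≠ x := by
      rintro rfl
      obtain ⟨f, hf, hfc, -⟩ := hcd
      exact hf hfc
    exact (ih hc).tail (ι.sharesEdgeOff_triangle (a := ⟨c, hc⟩) (b := ⟨d, hb⟩) hcd)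

theorem sharesEdgeOff_self (hX : X.IsProperMComplex) (a : {z : X.cell 2 // z ≠ x}) :
    K.SharesEdgeOff (ι.edge '' (Triangle.ofCell x).edgeSet) (ι.triangle a) (ι.triangle a) := by
  obtain ⟨f, hfa, hfx⟩ := hX.exists_isEdge_notMem a.2
  exact ι.sharesEdgeOff_triangle ⟨f, hfx, hfa, hfa⟩

end PuncturedEmbedding

theorem isReducible_of_puncturedEmbedding (hX : X.IsProperMComplex) (hY : Y.IsProperMComplex)
    (ι : PuncturedEmbedding X x K) (κ : PuncturedEmbedding Y y K) (t : K.Triangle)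
    (hι : ι.edge '' (Triangle.ofCell x).edgeSet = t.edgeSet)
    (hκ : κ.edge '' (Triangle.ofCell y).edgeSet = t.edgeSet)
    (hcompl : (Set.range ι.triangle)ᶜ = Set.range κ.triangle)
    (hinter : ∀ f g, ι.edge f = κ.edge g → f ∈ (Triangle.ofCell x).edgeSet) :
    K.IsReducible := by
  have := hX.1.nontrivial_ker_boundaryTwo
  have := hY.1.nontrivial_ker_boundaryTwo
  obtain ⟨a, ha⟩ := hX.1.isPseudosurface.exists_ne x
  obtain ⟨b, hb⟩ := hY.1.isPseudosurface.exists_ne y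
  have hsep : t.Separates (Set.range ι.triangle) := by
    refine ⟨⟨_, ⟨a, ha⟩, rfl⟩, ⟨κ.triangle ⟨b, hb⟩, hcompl.ge ⟨_, rfl⟩⟩, ?_⟩
    rintro f ⟨_, ⟨z, rfl⟩, b, hb, hfz, hfb⟩
    obtain ⟨z', rfl⟩ := hcompl.le hb
    obtain ⟨g, -, rfl⟩ := ι.isEdge_triangle_iff.1 hfz
    obtain ⟨g', -, hg'⟩ := κ.isEdge_triangle_iff.1 hfb
    exact hι ▸ Set.mem_image_of_mem _ (hinter g g' hg'.symm)
  refine hsep.isReducible (fun c => ?_) ?_ ?_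
  · by_cases hc : c ∈ Set.range ι.triangle
    · obtain ⟨z, rfl⟩ := hc
      exact hι ▸ ι.sharesEdgeOff_self hX z
    · obtain ⟨z, rfl⟩ := hcompl.le hc
      exact hκ ▸ κ.sharesEdgeOff_self hY z
  · rintro _ ⟨z, rfl⟩ _ ⟨z', rfl⟩
    exact hι ▸ ι.reflTransGen_sharesEdgeOff hX.1.isPseudosurface z z'
  · rw [hcompl]
    rintro _ ⟨z, rfl⟩ _ ⟨z', rfl⟩
    exact hκ ▸ κ.reflTransGen_sharesEdgeOff hY.1.isPseudosurface z z'

end Puncture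

/-! ### Connected sums are reducible -/

section ConnectedSumEmbedding

variable {X Y : DeltaComplex.{u}} {x : X.cell 2} {y : Y.cell 2}

theorem edgeGlue_inl_injective (hY : Y.Loopless) :
    Function.Injective fun f => Quot.mk (EdgeGlue X Y x y) (.inl f) := by
  let retract : Quot (EdgeGlue X Y x y) → X.cell 1 ⊕ Y.cell 1 :=
    Quot.lift (Sum.elim .inl
      (Function.extend (Triangle.ofCell y).edge (.inl ∘ (Triangle.ofCell x).edge) .inr))
      fun _ _ h => by
        cases h with
        | mk i =>
          exact (((Triangle.ofCell y).edge_injective hY).extend_apply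
            (Sum.inl ∘ (Triangle.ofCell x).edge) Sum.inr i).symm
  intro f f' h
  exact Sum.inl_injective (congrArg retract h)

/-- The map from the glued 1-cells that names them by 1-cells of `Y` where possible. -/
noncomputable def edgeGlueRetraction (hX : X.Loopless) :
    Quot (EdgeGlue X Y x y) → X.cell 1 ⊕ Y.cell 1 :=
  Quot.lift (Sum.elim
      (Function.extend (Triangle.ofCell x).edge (.inr ∘ (Triangle.ofCell y).edge) .inl) .inr)
    fun _ _ h => by
      cases h with
      | mk i => exact ((Triangle.ofCell x).edge_injective hX).extend_apply _ _ i

theorem edgeGlue_inr_injective (hX : X.Loopless) :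
    Function.Injective fun g => Quot.mk (EdgeGlue X Y x y) (.inr g) :=
  fun _ _ h => Sum.inr_injective (congrArg (edgeGlueRetraction hX) h)

theorem mem_edgeSet_of_edgeGlue_eq (hX : X.Loopless) {f : X.cell 1} {g : Y.cell 1}
    (h : Quot.mk (EdgeGlue X Y x y) (.inl f) = Quot.mk (EdgeGlue X Y x y) (.inr g)) :
    f ∈ (Triangle.ofCell x).edgeSet := by
  by_contra hf
  have hfg := congrArg (edgeGlueRetraction hX) h
  exact Sum.inl_ne_inr ((Function.extend_apply' _ _ f hf).symm.trans hfg)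

/-- The inclusion of `X` without `x` in a connected sum. -/
def inlEmbedding (hY : Y.Loopless) : PuncturedEmbedding X x (connectedSum X Y x y) where
  edge f := Quot.mk _ (.inl f)
  triangle := .inl
  edge_injective := edgeGlue_inl_injective hY
  face_triangle _ _ := rfl

/-- The inclusion of `Y` without `y` in a connected sum. -/
def inrEmbedding (hX : X.Loopless) : PuncturedEmbedding Y y (connectedSum X Y x y) where
  edge f := Quot.mk _ (.inr f)
  triangle := .inr
  edge_injective := edgeGlue_inr_injective hX
  face_triangle _ _ := rfl

/-- The triangle of a connected sum along which its summands are glued. -/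
def seam (X Y : DeltaComplex.{u}) (x : X.cell 2) (y : Y.cell 2) :
    (connectedSum X Y x y).Triangle where
  edge i := Quot.mk _ (.inl (X.face i x))
  face_face i j hij :=
    congrArg (fun w => Quot.mk (VertexGlue X Y x y) (.inl w)) (X.face_face i j hij x)

/-- The image of a triangle under a morphism. -/
def Triangle.map (φ : Hom K L) (t : K.Triangle) : L.Triangle where
  edge i := φ.map 1 (t.edge i)
  face_face i j hij := by rw [← φ.map_face, ← φ.map_face, t.face_face i j hij]

theorem IsDecomposable.isReducible (h : K.IsDecomposable) : K.IsReducible := by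
  obtain ⟨X, Y, x, y, hX, hY, hiso⟩ := h
  obtain ⟨φ, hφ⟩ := hiso.symm
  refine isReducible_of_puncturedEmbedding hX hY ((inlEmbedding hY.1.loopless).comp φ (hφ 1).1)
    ((inrEmbedding hX.1.loopless).comp φ (hφ 1).1) ((seam X Y x y).map φ) ?_ ?_ ?_
    fun f g hfg => mem_edgeSet_of_edgeGlue_eq hX.1.loopless ((hφ 1).1 hfg)
  · exact (Set.range_comp _ _).symm
  · refine (Set.range_comp _ _).symm.trans (congrArg Set.range (funext fun i => ?_))
    exact congrArg (φ.map 1) (Quot.sound (EdgeGlue.mk i)).symm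
  · let q : {z // z ≠ x} ⊕ {z // z ≠ y} → K.cell 2 := φ.map 2
    change (Set.range (q ∘ Sum.inl))ᶜ = Set.range (q ∘ Sum.inr)
    have hq : Function.Bijective q := hφ 2
    rw [Set.range_comp, Set.range_comp, ← Set.image_compl_eq hq, Set.compl_range_inl]

end ConnectedSumEmbedding

/-! ### Capping a set of 2-cells -/

section Cap

/-- The edges of `t` and of the 2-cells in `A`. -/
def capEdges (t : K.Triangle) (A : Set (K.cell 2)) : Set (K.cell 1) :=
  t.edgeSet ∪ {f | ∃ a ∈ A, K.IsEdge f a}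

/-- The cells of `cap t A`. -/
def CapCell (t : K.Triangle) (A : Set (K.cell 2)) : ℕ → Type u
  | 0 => {w // ∃ f ∈ capEdges t A, K.IsVertexOfEdge w f}
  | 1 => {f // f ∈ capEdges t A}
  | 2 => Option A
  | _ + 3 => PEmpty

/-- The faces of `cap t A`. -/
def capFace {t : K.Triangle} {A : Set (K.cell 2)} :
    {n : ℕ} → Fin (n + 2) → CapCell t A (n + 1) → CapCell t A n
  | 0, i, f => ⟨K.face i f.1, f.1, f.2, i, rfl⟩
  | 1, i, some a => ⟨K.face i a.1, .inr ⟨a.1, a.2, i, rfl⟩⟩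
  | 1, i, none => ⟨t.edge i, .inl ⟨i, rfl⟩⟩
  | _ + 2, _, c => PEmpty.elim c

/-- The complex obtained from the 2-cells in `A` by adding one 2-cell with boundary `t`. -/
def cap (t : K.Triangle) (A : Set (K.cell 2)) : DeltaComplex.{u} where
  cell := CapCell t A
  face := capFace
  face_face {n} i j hij c :=
    match n, c with
    | 0, some a => Subtype.ext (K.face_face i j hij a.1)
    | 0, none => Subtype.ext (t.face_face i j hij)
    | _ + 1, c => PEmpty.elim c

/-- The inclusion of the 0-cells of `cap t A` in those of `K`. -/
def capVertex {t : K.Triangle} {A : Set (K.cell 2)} (w : (cap t A).cell 0) : K.cell 0 := w.1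

/-- The inclusion of the 1-cells of `cap t A` in those of `K`. -/
def capEdge {t : K.Triangle} {A : Set (K.cell 2)} (f : (cap t A).cell 1) : K.cell 1 := f.1

/-- The inclusion of `A` in the 2-cells of `cap t A`. -/
def capInclusion (t : K.Triangle) {A : Set (K.cell 2)} (a : A) : (cap t A).cell 2 := some a

/-- The 2-cell with boundary `t` that is added to `A` in `cap t A`. -/
def capCell (t : K.Triangle) (A : Set (K.cell 2)) : (cap t A).cell 2 := (none : Option A)

variable {t : K.Triangle} {A : Set (K.cell 2)}

theorem capEdge_injective : Function.Injective (capEdge (t := t) (A := A)) :=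
  Subtype.val_injective

theorem isEdge_capInclusion {f : (cap t A).cell 1} {a : A} :
    (cap t A).IsEdge f (capInclusion t a) ↔ K.IsEdge (capEdge f) a :=
  exists_congr fun _ => Subtype.ext_iff

theorem isEdge_capCell {f : (cap t A).cell 1} :
    (cap t A).IsEdge f (capCell t A) ↔ capEdge f ∈ t.edgeSet :=
  exists_congr fun _ => Subtype.ext_iff

theorem isVertexOfEdge_cap {w : (cap t A).cell 0} {f : (cap t A).cell 1} :
    (cap t A).IsVertexOfEdge w f ↔ K.IsVertexOfEdge (capVertex w) (capEdge f) :=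
  exists_congr fun _ => Subtype.ext_iff

theorem mem_capEdges_iff (hA : K.frontier A = t.edgeSet) {f : K.cell 1} :
    f ∈ capEdges t A ↔ ∃ a ∈ A, K.IsEdge f a := by
  refine ⟨?_, .inr⟩
  rintro (hf | hf)
  · obtain ⟨a, ha, -, -, hfa, -⟩ := hA.ge hf
    exact ⟨a, ha, hfa⟩
  · exact hf

open Classical in
/-- The map onto the 2-cells of `cap t A` that sends all 2-cells outside `A` to the added one. -/
noncomputable def collapse (t : K.Triangle) (A : Set (K.cell 2)) (z : K.cell 2) :
    (cap t A).cell 2 :=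
  if h : z ∈ A then capInclusion t ⟨z, h⟩ else capCell t A

theorem collapse_of_mem {z : K.cell 2} (hz : z ∈ A) : collapse t A z = capInclusion t ⟨z, hz⟩ :=
  dif_pos hz

theorem collapse_of_notMem {z : K.cell 2} (hz : z ∉ A) : collapse t A z = capCell t A :=
  dif_neg hz

theorem eq_of_collapse_eq {a z : K.cell 2} (ha : a ∈ A) (h : collapse t A a = collapse t A z) :
    a = z := by
  rw [collapse_of_mem ha] at h
  by_cases hz : z ∈ A
  · rw [collapse_of_mem hz] at h
    exact congrArg Subtype.val (Option.some_injective _ h)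
  · rw [collapse_of_notMem hz] at h
    exact absurd h (Option.some_ne_none _)

theorem collapse_surjective (hA : K.frontier A = t.edgeSet) :
    Function.Surjective (collapse t A) := by
  rintro (_ | a)
  · obtain ⟨-, -, b, hb, -, -⟩ := hA.ge (t.edge_mem_edgeSet 0)
    exact ⟨b, collapse_of_notMem hb⟩
  · exact ⟨a.1, collapse_of_mem a.2⟩

theorem isEdge_collapse (hA : K.frontier A = t.edgeSet) {f : (cap t A).cell 1} {z : K.cell 2}
    (hf : K.IsEdge (capEdge f) z) : (cap t A).IsEdge f (collapse t A z) := by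
  by_cases hz : z ∈ A
  · rwa [collapse_of_mem hz, isEdge_capInclusion]
  · obtain ⟨a, ha, hfa⟩ := (mem_capEdges_iff hA).1 f.2
    rw [collapse_of_notMem hz, isEdge_capCell, ← hA]
    exact ⟨a, ha, z, hz, hfa, hf⟩

theorem isEdge_cap_iff (hA : K.frontier A = t.edgeSet) {f : (cap t A).cell 1}
    {u : (cap t A).cell 2} :
    (cap t A).IsEdge f u ↔ ∃ z, K.IsEdge (capEdge f) z ∧ collapse t A z = u := by
  refine ⟨fun hf => ?_, ?_⟩
  · match u with
    | some a => exact ⟨a, isEdge_capInclusion.1 hf, collapse_of_mem a.2⟩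
    | none =>
      obtain ⟨-, -, b, hb, -, hfb⟩ := hA.ge (isEdge_capCell.1 hf)
      exact ⟨b, hfb, collapse_of_notMem hb⟩
  · rintro ⟨z, hz, rfl⟩
    exact isEdge_collapse hA hz

theorem reflTransGen_collapse (hA : K.frontier A = t.edgeSet) {S : Set (K.cell 1)}
    {z z' : K.cell 2} (h : Relation.ReflTransGen (K.SharesEdgeIn S) z z') :
    Relation.ReflTransGen ((cap t A).SharesEdgeIn {f | capEdge f ∈ S})
      (collapse t A z) (collapse t A z') := by
  refine h.lift' (collapse t A) fun y y' ⟨f, hfS, hfy, hfy'⟩ => ?_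
  rw [Function.onFun]
  by_cases hf : f ∈ capEdges t A
  · exact .single ⟨⟨f, hf⟩, hfS, isEdge_collapse hA hfy, isEdge_collapse hA hfy'⟩
  · have hout {y} (hy : K.IsEdge f y) : y ∉ A := fun hyA => hf (.inr ⟨y, hyA, hy⟩)
    rw [collapse_of_notMem (hout hfy), collapse_of_notMem (hout hfy')]

theorem ncard_setOf_isEdge_cap (hA : K.frontier A = t.edgeSet) {f : (cap t A).cell 1}
    (hf : {x | K.IsEdge (capEdge f) x}.ncard = 2) : {u | (cap t A).IsEdge f u}.ncard = 2 := by
  obtain ⟨a, ha, hfa⟩ := (mem_capEdges_iff hA).1 f.2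
  obtain ⟨b, hfb, hba⟩ := Set.exists_ne_of_one_lt_ncard (hf ▸ one_lt_two) a
  have himage : {u | (cap t A).IsEdge f u} = collapse t A '' {x | K.IsEdge (capEdge f) x} :=
    Set.ext fun _ => isEdge_cap_iff hA
  rw [himage, setOf_isEdge_eq_pair hf hfa hfb hba.symm, Set.image_pair, Set.ncard_pair]
  exact fun h => hba (eq_of_collapse_eq ha h).symm

theorem IsPseudosurface.cap (hK : K.IsPseudosurface) (hA : K.frontier A = t.edgeSet) :
    (cap t A).IsPseudosurface where
  loopless f h := hK.loopless (capEdge f) (congrArg Subtype.val h)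
  two_triangles f := ncard_setOf_isEdge_cap hA (hK.two_triangles (capEdge f))
  stronglyConnected u u' := by
    obtain ⟨z, rfl⟩ := collapse_surjective hA u
    obtain ⟨z', rfl⟩ := collapse_surjective hA u'
    exact reflTransGen_collapse hA (hK.stronglyConnected z z')

theorem linked_cap (hA : K.frontier A = t.edgeSet)
    (hlinked : ∀ w x x', K.IsVertex w x → K.IsVertex w x' →
      Relation.ReflTransGen (K.Neighbours w) x x')
    {w : (cap t A).cell 0} {u u' : (cap t A).cell 2} (hu : (cap t A).IsVertex w u)
    (hu' : (cap t A).IsVertex w u') : Relation.ReflTransGen ((cap t A).Neighbours w) u u' := by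
  obtain ⟨f, hfu, hwf⟩ := hu
  obtain ⟨f', hfu', hwf'⟩ := hu'
  obtain ⟨z, hz, rfl⟩ := (isEdge_cap_iff hA).1 hfu
  obtain ⟨z', hz', rfl⟩ := (isEdge_cap_iff hA).1 hfu'
  have hpath := hlinked (capVertex w) z z' ⟨capEdge f, hz, isVertexOfEdge_cap.1 hwf⟩
    ⟨capEdge f', hz', isVertexOfEdge_cap.1 hwf'⟩
  exact Relation.ReflTransGen.mono (fun _ _ ⟨g, hg, h⟩ => ⟨g, isVertexOfEdge_cap.2 hg, h⟩) _ _
    (reflTransGen_collapse hA (S := {g | K.IsVertexOfEdge (capVertex w) g}) hpath)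

theorem mapDomain_boundaryTwo {ι : Type*} {φ : L.cell 1 → K.cell 1} {p : ι → L.cell 2}
    {q : ι → K.cell 2} (h : ∀ i a, φ (L.face i (p a)) = K.face i (q a)) (c : ι →₀ ℤ) :
    Finsupp.mapDomain φ (L.boundaryTwo (Finsupp.mapDomain p c)) =
      K.boundaryTwo (Finsupp.mapDomain q c) := by
  induction c using Finsupp.induction_linear with
  | zero => simp
  | add c d hc hd => simp only [Finsupp.mapDomain_add, map_add, hc, hd]
  | single a k =>
    rw [Finsupp.mapDomain_single, Finsupp.mapDomain_single, boundaryTwo_single, boundaryTwo_single,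
      Finsupp.mapDomain_smul, Triangle.mapDomain_chain (t := .ofCell (q a)) fun i => h i a]

theorem nontrivial_ker_boundaryTwo_cap {d : K.cell 2 →₀ ℤ} (hdA : ↑d.support ⊆ A) {k : ℤ}
    (hk : k ≠ 0) (hd : K.boundaryTwo d = k • t.chain) :
    Nontrivial (LinearMap.ker (cap t A).boundaryTwo) := by
  obtain ⟨c, rfl⟩ : ∃ c : A →₀ ℤ, c.mapDomain Subtype.val = d :=
    ⟨_, Finsupp.mapDomain_comapDomain _ Subtype.val_injective d (by rwa [Subtype.range_val])⟩
  have hboundary : (cap t A).boundaryTwo (c.mapDomain (capInclusion t)) =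
      (cap t A).boundaryTwo (Finsupp.single (capCell t A) k) := by
    apply Finsupp.mapDomain_injective capEdge_injective
    rw [mapDomain_boundaryTwo (q := Subtype.val) fun _ _ => rfl, hd, boundaryTwo_single,
      Finsupp.mapDomain_smul, Triangle.mapDomain_chain (t := t) fun _ => rfl]
  refine nontrivial_of_ne ⟨c.mapDomain (capInclusion t) - Finsupp.single (capCell t A) k,
    by rw [LinearMap.mem_ker, map_sub, hboundary, sub_self]⟩ 0 fun hzero => hk ?_
  have happly := DFunLike.congr_fun (congrArg Subtype.val hzero) (capCell t A)
  have hrange : capCell t A ∉ Set.range (capInclusion t (A := A)) := by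
    rintro ⟨a, ha⟩
    exact Option.some_ne_none a ha
  simpa [Finsupp.mapDomain_of_notMem_range _ _ hrange] using happly

theorem finite_capCell [∀ n, Finite (K.cell n)] : ∀ n, Finite (CapCell t A n)
  | 0 => inferInstanceAs (Finite {w // ∃ f ∈ capEdges t A, K.IsVertexOfEdge w f})
  | 1 => inferInstanceAs (Finite {f // f ∈ capEdges t A})
  | 2 => inferInstanceAs (Finite (Option A))
  | _ + 3 => inferInstanceAs (Finite PEmpty)

theorem isEmpty_capCell {m : ℕ} (hm : 3 ≤ m) : IsEmpty (CapCell t A m) := by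
  obtain ⟨m, rfl⟩ := Nat.exists_eq_add_of_le' hm
  exact inferInstanceAs (IsEmpty PEmpty)

theorem cap_isMComplex (hK : K.IsMComplex) (h : t.Separates A) : (cap t A).IsMComplex := by
  have := hK.nontrivial_ker_boundaryTwo
  have := hK.finite
  have hfinite (n : ℕ) : Finite (K.cell n) :=
    Finite.of_injective (Sigma.mk n : _ → Σ n, K.cell n) sigma_mk_injective
  have hA := h.frontier_eq hK.isPseudosurface
  have hcap := hK.isPseudosurface.cap hA
  have hvertex (w : (cap t A).cell 0) : ∃ f, (cap t A).IsVertexOfEdge w f := by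
    obtain ⟨w, f, hf, hwf⟩ := w
    exact ⟨⟨f, hf⟩, isVertexOfEdge_cap.2 hwf⟩
  have hedge (f : (cap t A).cell 1) : ∃ u, (cap t A).IsEdge f u := by
    obtain ⟨a, -, hfa⟩ := (mem_capEdges_iff hA).1 f.2
    exact ⟨collapse t A a, isEdge_collapse hA hfa⟩
  refine
    { connected := hcap.connected fun w => ?_
      finite := finite_sigma_of_isEmpty finite_capCell fun _ => isEmpty_capCell
      empty_of_three_le := fun _ => isEmpty_capCell
      exists_edge := hvertex
      exists_triangle := hedge
      regular_two := ?_
      regular_one := hcap.loopless.face_injective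
      two_triangles := hcap.two_triangles
      linked := fun _ _ _ => linked_cap hA hK.linked
      orientable := ?_ }
  · obtain ⟨f, hwf⟩ := hvertex w
    obtain ⟨u, hfu⟩ := hedge f
    exact ⟨u, f, hfu, hwf⟩
  · exact fun u => (Triangle.ofCell u).edge_injective hcap.loopless
  · obtain ⟨d, hdA, k, hk, hd⟩ := h.exists_boundaryTwo_eq_smul_chain hK.isPseudosurface
    have := nontrivial_ker_boundaryTwo_cap hdA.le hk hd
    exact hcap.nonempty_ker_boundaryTwo_equiv

theorem cap_not_isIdentity (h : ∀ a, K.SharesEdgeOff t.edgeSet a a) : ¬ (cap t A).IsIdentity := by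
  rintro ⟨u, u', hne, hall, hface⟩
  have hface_ne (a : A) :
      ¬ ∀ i : Fin 3, (cap t A).face i (capInclusion t a) = (cap t A).face i (capCell t A) := by
    obtain ⟨_, hf, ⟨i, rfl⟩, -⟩ := h a
    exact fun hi => hf ⟨i, (congrArg capEdge (hi i)).symm⟩
  match u, u' with
  | none, none => exact hne rfl
  | some a, none => exact hface_ne a hface
  | none, some a => exact hface_ne a fun i => (hface i).symm
  | some a, some b => cases hall (capCell t A) <;> contradiction

end Cap

/-! ### Gluing the two caps -/

section Glue

variable {t : K.Triangle} {A : Set (K.cell 2)}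

/-- The 2-cell of `K` given by a 2-cell of `cap t A` other than the added one. -/
def capTriangle : {z : (cap t A).cell 2 // z ≠ capCell t A} → K.cell 2
  | ⟨some a, _⟩ => a.1
  | ⟨none, h⟩ => absurd rfl h

/-- The map on cells from the connected sum of `cap t A` and `cap t Aᶜ` to `K`. -/
def glueMap (t : K.Triangle) (A : Set (K.cell 2)) : (n : ℕ) →
    SumCell (cap t A) (cap t Aᶜ) (capCell t A) (capCell t Aᶜ) n → K.cell n
  | 0 => Quot.lift (Sum.elim Subtype.val Subtype.val) fun _ _ h => by cases h; rfl
  | 1 => Quot.lift (Sum.elim Subtype.val Subtype.val) fun _ _ h => by cases h; rfl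
  | 2 => Sum.elim capTriangle capTriangle
  | _ + 3 => PEmpty.elim

theorem glueMap_face {n : ℕ} (i : Fin (n + 2))
    (c : SumCell (cap t A) (cap t Aᶜ) (capCell t A) (capCell t Aᶜ) (n + 1)) :
    glueMap t A n (sumFace _ _ _ _ i c) = K.face i (glueMap t A (n + 1) c) := by
  match n, c with
  | 0, c =>
    induction c using Quot.inductionOn with | _ c
    rcases c with c | c <;> rfl
  | 1, .inl ⟨some a, _⟩ => rfl
  | 1, .inl ⟨none, h⟩ => exact absurd rfl h
  | 1, .inr ⟨some a, _⟩ => rfl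
  | 1, .inr ⟨none, h⟩ => exact absurd rfl h
  | _ + 2, c => exact PEmpty.elim c

theorem mem_edgeSet_of_mem_capEdges (hA : K.frontier A = t.edgeSet) {f : K.cell 1}
    (hf : f ∈ capEdges t A) (hf' : f ∈ capEdges t Aᶜ) : f ∈ t.edgeSet := by
  obtain ⟨a, ha, hfa⟩ := (mem_capEdges_iff hA).1 hf
  obtain ⟨b, hb, hfb⟩ := (mem_capEdges_iff ((frontier_compl A).trans hA)).1 hf'
  exact hA.le ⟨a, ha, b, hb, hfa, hfb⟩

theorem mem_capEdges_or_mem_capEdges_compl (htriangle : ∀ f, ∃ x, K.IsEdge f x) (f : K.cell 1) :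
    f ∈ capEdges t A ∨ f ∈ capEdges t Aᶜ := by
  obtain ⟨x, hx⟩ := htriangle f
  by_cases hxA : x ∈ A
  exacts [.inl (.inr ⟨x, hxA, hx⟩), .inr (.inr ⟨x, hxA, hx⟩)]

theorem glueMap_one_bijective (htriangle : ∀ f, ∃ x, K.IsEdge f x) (hA : K.frontier A = t.edgeSet) :
    Function.Bijective (glueMap t A 1) := by
  refine bijective_quotLift_val (mem_capEdges_or_mem_capEdges_compl htriangle) _ fun f hf hf' => ?_
  obtain ⟨j, rfl⟩ := mem_edgeSet_of_mem_capEdges hA hf hf'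
  exact Quot.sound (EdgeGlue.mk j)

theorem exists_isVertexOfEdge_edge (hA : K.frontier A = t.edgeSet)
    (hlinked : ∀ w x x', K.IsVertex w x → K.IsVertex w x' →
      Relation.ReflTransGen (K.Neighbours w) x x')
    {w : K.cell 0} (hw : ∃ f ∈ capEdges t A, K.IsVertexOfEdge w f)
    (hw' : ∃ f ∈ capEdges t Aᶜ, K.IsVertexOfEdge w f) : ∃ j, K.IsVertexOfEdge w (t.edge j) := by
  obtain ⟨f, hf, hwf⟩ := hw
  obtain ⟨f', hf', hwf'⟩ := hw'
  obtain ⟨a, ha, hfa⟩ := (mem_capEdges_iff hA).1 hf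
  obtain ⟨b, hb, hfb⟩ := (mem_capEdges_iff ((frontier_compl A).trans hA)).1 hf'
  obtain ⟨g, hwg, hg⟩ := exists_mem_frontier_of_reflTransGen (S := {g | K.IsVertexOfEdge w g})
    (hlinked w a b ⟨f, hfa, hwf⟩ ⟨f', hfb, hwf'⟩) ha hb
  obtain ⟨j, rfl⟩ := hA.le hg
  exact ⟨j, hwg⟩

theorem glueMap_zero_bijective (hK : K.IsMComplex) (hA : K.frontier A = t.edgeSet) :
    Function.Bijective (glueMap t A 0) := by
  refine bijective_quotLift_val (fun w => ?_) _ fun w hw hw' => ?_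
  · obtain ⟨f, hwf⟩ := hK.exists_edge w
    exact (mem_capEdges_or_mem_capEdges_compl hK.exists_triangle f).imp
      (fun hf => ⟨f, hf, hwf⟩) fun hf => ⟨f, hf, hwf⟩
  · obtain ⟨j, i, rfl⟩ := exists_isVertexOfEdge_edge hA hK.linked hw hw'
    exact Quot.sound (VertexGlue.mk i j)

theorem capTriangle_injective : Function.Injective (capTriangle (t := t) (A := A)) := by
  rintro ⟨_ | a, ha⟩ ⟨_ | b, hb⟩ h
  exacts [absurd rfl ha, absurd rfl ha, absurd rfl hb, Subtype.ext (congrArg some (Subtype.ext h))]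

theorem range_capTriangle : Set.range (capTriangle (t := t) (A := A)) = A := by
  refine Set.Subset.antisymm ?_ fun a ha => ⟨⟨some ⟨a, ha⟩, Option.some_ne_none _⟩, rfl⟩
  rintro _ ⟨⟨_ | a, ha⟩, rfl⟩
  exacts [absurd rfl ha, a.2]

theorem glueMap_two_bijective : Function.Bijective (glueMap t A 2) := by
  refine ⟨capTriangle_injective.sumElim capTriangle_injective fun z z' h => ?_,
    Set.range_eq_univ.1 ((Set.Sum.elim_range _ _).trans ?_)⟩
  · have hz : capTriangle z ∈ A := range_capTriangle.le ⟨z, rfl⟩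
    have hz' : capTriangle z' ∈ Aᶜ := range_capTriangle.le ⟨z', rfl⟩
    exact hz' (h ▸ hz)
  · rw [range_capTriangle, range_capTriangle, Set.union_compl_self]

theorem isomorphic_connectedSum_cap (hK : K.IsMComplex) (hA : K.frontier A = t.edgeSet) :
    K.Isomorphic (connectedSum (cap t A) (cap t Aᶜ) (capCell t A) (capCell t Aᶜ)) := by
  refine Isomorphic.symm ⟨⟨glueMap t A, fun _ => glueMap_face⟩, fun n => ?_⟩
  match n with
  | 0 => exact glueMap_zero_bijective hK hA
  | 1 => exact glueMap_one_bijective hK.exists_triangle hA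
  | 2 => exact glueMap_two_bijective
  | m + 3 =>
    have := hK.empty_of_three_le (m + 3) (Nat.le_add_left 3 m)
    exact ⟨fun c => PEmpty.elim c, fun a => isEmptyElim a⟩

end Glue

theorem IsReducible.isDecomposable (h : K.IsReducible) (hK : K.IsMComplex) :
    K.IsDecomposable := by
  obtain ⟨t, A, hsep, hoff⟩ := h.exists_separates hK.loopless
  have := hK.nontrivial_ker_boundaryTwo
  exact ⟨cap t A, cap t Aᶜ, capCell t A, capCell t Aᶜ,
    ⟨cap_isMComplex hK hsep, cap_not_isIdentity hoff⟩,
    ⟨cap_isMComplex hK hsep.compl, cap_not_isIdentity hoff⟩,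
    isomorphic_connectedSum_cap hK (hsep.frontier_eq hK.isPseudosurface)⟩

end DeltaComplex

theorem mainTheorem4 (K : DeltaComplex.{u}) (hK : K.IsMComplex) :
    K.IsReducible ↔ K.IsDecomposable :=
  ⟨fun h => h.isDecomposable hK, fun h => h.isReducible⟩
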